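/- Let $A$ be a commutative unital $\mathbb{R}$-algebra and let $\rho:A\to[0,\infty)$ be a submultiplicative seminorm, i.e. $\rho(ra)=|r|\rho(a)$, $\rho(a+b)\le\rho(a)+\rho(b)$ and $\rho(ab)\le\rho(a)\rho(b)$ for all $a,b\in A$, $r\in\mathbb{R}$. Let $\mathcal{X}(A)$ be the set of all unital $\mathbb{R}$-algebra homomorphisms $\alpha:A\to\mathbb{R}$, endowed with the weakest topology making every map $\hat a:\mathcal{X}(A)\to\mathbb{R}$, $\hat a(\alpha)=\alpha(a)$ $(a\in A)$, continuous, and with its Borel $\sigma$-algebra. Let $d\ge 1$ be an integer and let $S\subseteq A$ be a $\sum A^{2d}$-module, i.e. $S$ is closed under sums and under multiplication by nonnegative real numbers, $1\in S$, and $a^{2d}S\subseteq S$ for every $a\in A$. Put $$\mathrm{Sp}_\rho(A)=\{\alpha\in\mathcal{X}(A): |\alpha(a)|\le\rho(a)\ \text{for all } a\in A\},\qquad K_S=\{\alpha\in\mathcal{X}(A):\alpha(s)\ge 0\ \text{for all } s\in S\}.$$ Let $B\subseteq A$ be a linear subspace and $L:B\to\mathbb{R}$ a linear functional. Then the following are equivalent: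 1. There is a positive Radon measure $\mu$ on $\mathcal{X}(A)$ (a Borel measure that is locally finite and inner regular with respect to compact sets) whose support is contained in $K=\mathrm{Sp}_\rho(A)\cap K_S$, in the sense that $\mu(M)=0$ for every Borel set $M\subseteq\mathcal{X}(A)$ with $M\cap K=\emptyset$, such that for every $b\in B$ the function $\hat b$ is $\mu$-integrable and $L(b)=\int\hat b\,d\mu$. 2. There is a real number $D>0$ such that $L(b)\le D\,\inf_{p\in S}\rho(b+p)$ for all $b\in B$. -/

import Mathlib

open MeasureTheory

noncomputable section

/-- The real-valued characters of a commutative unital real algebra `A`, i.e. the unital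
`ℝ`-algebra homomorphisms from `A` to `ℝ`. -/
def CharSpace (A : Type*) [CommRing A] [Algebra ℝ A] : Type _ := A →ₐ[ℝ] ℝ

namespace CharSpace

instance instFunLike (A : Type*) [CommRing A] [Algebra ℝ A] : FunLike (CharSpace A) A ℝ :=
  inferInstanceAs (FunLike (A →ₐ[ℝ] ℝ) A ℝ)

instance instAlgHomClass (A : Type*) [CommRing A] [Algebra ℝ A] :
    AlgHomClass (CharSpace A) ℝ A ℝ :=
  inferInstanceAs (AlgHomClass (A →ₐ[ℝ] ℝ) ℝ A ℝ)

/-- The weakest topology on the character space that makes all evaluations `α ↦ α a` continuous,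
i.e. the topology induced from the product topology of `A → ℝ`. -/
instance instTopologicalSpace (A : Type*) [CommRing A] [Algebra ℝ A] :
    TopologicalSpace (CharSpace A) :=
  TopologicalSpace.induced (fun (α : CharSpace A) (a : A) => α a) inferInstance

/-- The character space carries its Borel sigma-algebra. -/
instance instMeasurableSpace (A : Type*) [CommRing A] [Algebra ℝ A] :
    MeasurableSpace (CharSpace A) :=
  borel (CharSpace A)

instance instBorelSpace (A : Type*) [CommRing A] [Algebra ℝ A] : BorelSpace (CharSpace A) :=
  ⟨rfl⟩

end CharSpace

/-- The common nonnegativity set of `S` on the character space. -/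
def nonnegSet {A : Type*} [CommRing A] [Algebra ℝ A] (S : Set A) : Set (CharSpace A) :=
  {α | ∀ s ∈ S, 0 ≤ α s}

/-- The Gelfand spectrum of `(A, ρ)`. -/
def gelfandSpectrum {A : Type*} [CommRing A] [Algebra ℝ A] (ρ : Seminorm ℝ A) :
    Set (CharSpace A) :=
  {α | ∀ a : A, |α a| ≤ ρ a}

/-- A cone `S` (closed under sums and multiplication by nonnegative reals) is a
`∑ A^{2d}`-module if it contains `1` and `a ^ (2 * d) * S ⊆ S` for every `a` in `A`. -/
structure IsEvenPowerModule {A : Type*} [CommRing A] [Algebra ℝ A] (d : ℕ)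
    (S : PointedCone ℝ A) : Prop where
  one_mem : (1 : A) ∈ S
  pow_mul_mem : ∀ a : A, ∀ s ∈ S, a ^ (2 * d) * s ∈ S

/-- The sublinear function `a ↦ inf_{p ∈ C} ρ (a + p)` of a cone `C`. The infimum is over a
nonempty set of nonnegative reals. -/
def coneSublinear {A : Type*} [CommRing A] [Algebra ℝ A] (C : PointedCone ℝ A)
    (ρ : Seminorm ℝ A) (a : A) : ℝ :=
  ⨅ p : C, ρ (a + (p : A))

/-- A positive Radon measure: a Borel measure that is locally finite and inner regular with
respect to compact sets on all Borel sets. -/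
structure IsRadonMeasure {X : Type*} [TopologicalSpace X] [MeasurableSpace X]
    (μ : Measure X) : Prop where
  isLocallyFinite : IsLocallyFiniteMeasure μ
  innerRegular : μ.InnerRegular

/-- The support of `μ` is contained in `K`: every Borel set disjoint from `K` is `μ`-null. -/
def IsSupportedIn {X : Type*} [MeasurableSpace X] (μ : Measure X) (K : Set X) : Prop :=
  ∀ M : Set X, MeasurableSet M → M ∩ K = ∅ → μ M = 0

/-- `μ` is a `K`-representing measure for the linear functional `L` on the subspace `B`. -/
structure IsRepresentingMeasure {A : Type*} [CommRing A] [Algebra ℝ A] {B : Submodule ℝ A}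
    (L : B →ₗ[ℝ] ℝ) (K : Set (CharSpace A)) (μ : Measure (CharSpace A)) : Prop where
  radon : IsRadonMeasure μ
  supported : IsSupportedIn μ K
  integrable : ∀ b : B, Integrable (fun α : CharSpace A => α (b : A)) μ
  eq_integral : ∀ b : B, L b = ∫ α : CharSpace A, α (b : A) ∂μ

end

/-! Suppose `L` is dominated as in (2). Hahn–Banach extends `L` to `φ` on all of `A` under the same
sublinear bound. Taking `p = s` at `-s` shows `φ ≥ 0` on `S`; taking `p = 0` shows `|φ| ≤ D ρ`.

The link with characters is that `1 + a` with `ρ a < 1` is a `ρ`-limit of `2d`-th powers, by the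
binomial series for the root. Hence `φ ≥ 0` on `(1 + a) S` (`map_one_add_mul_nonneg`). Normalized
functionals of this kind form a compact convex set, and perturbing by the factors `1 ± u` shows that
its extreme points are multiplicative, hence characters in `K` (`map_mul_of_mem_extremePoints`). By
Krein–Milman, `φ a ≥ 0` whenever `â ≥ 0` on `K` (`map_nonneg`). The Riesz extension theorem and
Riesz–Markov on the compact set `K` then give the measure.

Conversely, `α b ≤ α (b + p) ≤ ρ (b + p)` on `K`, and `μ` is finite because `K` is compact;
integrate. -/

/-! ### Approximate roots of `1 + x` by the binomial series. -/

noncomputable section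

open Filter Topology Finset

/-- Evaluation of an absolutely convergent power series at `x` is compatible with powers. -/
theorem PowerSeries.summable_norm_and_tsum_pow {R : Type*} [NormedCommRing R] [NormedAlgebra ℝ R]
    [CompleteSpace R] (x : R) (f : PowerSeries ℝ)
    (hf : Summable fun k => ‖PowerSeries.coeff k f • x ^ k‖) (n : ℕ) :
    (Summable fun k => ‖PowerSeries.coeff k (f ^ n) • x ^ k‖) ∧
      ∑' k, PowerSeries.coeff k (f ^ n) • x ^ k = (∑' k, PowerSeries.coeff k f • x ^ k) ^ n := by
  induction n with
  | zero =>
    have h : ∀ k, k ∉ ({0} : Finset ℕ) →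
        PowerSeries.coeff k (f ^ 0) • x ^ k = 0 := by
      intro k hk
      have hk : k ≠ 0 := by simpa using hk
      simp [PowerSeries.coeff_one, hk]
    refine ⟨summable_of_ne_finset_zero (s := {0}) fun k hk => by rw [h k hk, norm_zero], ?_⟩
    rw [tsum_eq_sum h]
    simp
  | succ n ih =>
    have key : ∀ k, ∑ kl ∈ antidiagonal k,
        (PowerSeries.coeff kl.1 (f ^ n) • x ^ kl.1) * (PowerSeries.coeff kl.2 f • x ^ kl.2) =
        PowerSeries.coeff k (f ^ (n + 1)) • x ^ k := by
      intro k
      rw [pow_succ, PowerSeries.coeff_mul, Finset.sum_smul]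
      refine Finset.sum_congr rfl fun kl hkl => ?_
      rw [smul_mul_smul_comm, ← pow_add, mem_antidiagonal.1 hkl]
    constructor
    · simpa only [key] using summable_norm_sum_mul_antidiagonal_of_summable_norm ih.1 hf
    · rw [pow_succ (∑' k, _), ← ih.2, tsum_mul_tsum_eq_tsum_sum_antidiagonal_of_summable_norm ih.1 hf]
      simp only [key]

theorem PowerSeries.binomialSeries_pow (r : ℝ) (n : ℕ) :
    PowerSeries.binomialSeries ℝ r ^ n = PowerSeries.binomialSeries ℝ (n * r) := by
  induction n with
  | zero => simp
  | succ n ih => rw [pow_succ, ih, Nat.cast_succ, add_mul, one_mul, PowerSeries.binomialSeries_add]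

theorem summable_norm_binomialSeries_smul_pow {R : Type*} [NormedCommRing R] [NormedAlgebra ℝ R]
    (r : ℝ) {x : R} (hx : ‖x‖ < 1) :
    Summable fun k => ‖PowerSeries.coeff k (PowerSeries.binomialSeries ℝ r) • x ^ k‖ := by
  have h1 : ((‖x‖₊ : NNReal) : ENNReal) < (_root_.binomialSeries ℝ r).radius :=
    lt_of_lt_of_le (by exact_mod_cast hx) binomialSeries_radius_ge_one
  have h2 := (_root_.binomialSeries ℝ r).summable_norm_mul_pow h1
  -- The term `k = 0` is dropped because `‖x ^ 0‖ = ‖1‖` need not be at most `1`.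
  rw [← summable_nat_add_iff 1] at h2 ⊢
  refine Summable.of_nonneg_of_le (fun _ => norm_nonneg _) (fun k => ?_) h2
  rw [norm_smul]
  refine mul_le_mul ?_ (norm_pow_le' x k.succ_pos) (norm_nonneg _) (norm_nonneg _)
  simp [_root_.binomialSeries]

/-- In a Banach algebra, `1 + x` is the limit of `n`-th powers of polynomials in `x`
if `‖x‖ < 1`. -/
theorem exists_tendsto_sum_pow_one_add {R : Type*} [NormedCommRing R] [NormedAlgebra ℝ R]
    [CompleteSpace R] {n : ℕ} (hn : n ≠ 0) {x : R} (hx : ‖x‖ < 1) :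
    ∃ c : ℕ → ℝ, Tendsto (fun N => (∑ k ∈ range N, c k • x ^ k) ^ n) atTop (𝓝 (1 + x)) := by
  set f := PowerSeries.binomialSeries ℝ (1 / n : ℝ) with hf
  have hs := summable_norm_binomialSeries_smul_pow (1 / n : ℝ) hx
  refine ⟨fun k => PowerSeries.coeff k f, ?_⟩
  have h := (hs.of_norm.hasSum.tendsto_sum_nat).pow n
  rw [← (PowerSeries.summable_norm_and_tsum_pow x _ hs n).2] at h
  convert h using 2
  have hfn : PowerSeries.binomialSeries ℝ (1 / n : ℝ) ^ n = 1 + PowerSeries.X := by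
    rw [PowerSeries.binomialSeries_pow, mul_one_div_cancel (by exact_mod_cast hn)]
    simpa using PowerSeries.binomialSeries_nat (R := ℝ) (A := ℝ) 1
  rw [hfn, tsum_eq_sum (s := {0, 1})]
  · simp [PowerSeries.coeff_X, PowerSeries.coeff_one]
  · intro k hk
    simp only [mem_insert, mem_singleton, not_or] at hk
    simp [PowerSeries.coeff_X, PowerSeries.coeff_one, hk.1, hk.2]

/-- In a seminormed algebra, `1 + x` is a limit of `n`-th powers if `‖x‖ < 1`. -/
theorem exists_norm_pow_sub_one_add_lt {A : Type*} [SeminormedCommRing A] [NormedAlgebra ℝ A]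
    {n : ℕ} (hn : n ≠ 0) {x : A} (hx : ‖x‖ < 1) {ε : ℝ} (hε : 0 < ε) :
    ∃ y : A, ‖y ^ n - (1 + x)‖ < ε := by
  -- The series converges in the completion, but its partial sums are polynomials in `x` and so lie
  -- in `A`.
  have hx' : ‖(x : UniformSpace.Completion A)‖ < 1 := by
    rwa [UniformSpace.Completion.norm_coe]
  obtain ⟨c, hc⟩ := exists_tendsto_sum_pow_one_add hn hx'
  obtain ⟨N, hN⟩ := ((Metric.tendsto_nhds.1 hc) ε hε).exists
  refine ⟨∑ k ∈ range N, c k • x ^ k, ?_⟩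
  have hsm : ∀ (r : ℝ) (a : A), UniformSpace.Completion.coeRingHom (α := A) (r • a) =
      r • UniformSpace.Completion.coeRingHom (α := A) a :=
    fun r a => UniformSpace.Completion.coe_smul r a
  have he : UniformSpace.Completion.coeRingHom (α := A)
      ((∑ k ∈ range N, c k • x ^ k) ^ n - (1 + x)) =
      (∑ k ∈ range N, c k • (x : UniformSpace.Completion A) ^ k) ^ n - (1 + x) := by
    simp only [map_sub, map_pow, map_sum, map_add, map_one, hsm]
    rfl
  calc _ = ‖UniformSpace.Completion.coeRingHom (α := A)
        ((∑ k ∈ range N, c k • x ^ k) ^ n - (1 + x))‖ :=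
        (UniformSpace.Completion.norm_coe _).symm
    _ < ε := by rwa [he, ← dist_eq_norm]

/-- The seminormed ring structure defined by a submultiplicative seminorm. -/
abbrev Seminorm.toSeminormedCommRing {A : Type*} [CommRing A] [Algebra ℝ A] (ρ : Seminorm ℝ A)
    (hρ : ∀ a b : A, ρ (a * b) ≤ ρ a * ρ b) : SeminormedCommRing A :=
  { ρ.toAddGroupSeminorm.toSeminormedAddCommGroup, (inferInstance : CommRing A) with
    norm_mul_le := hρ }

/-- If `ρ` is submultiplicative and `ρ x < 1`, then `1 + x` is a `ρ`-limit of `n`-th powers. -/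
theorem Seminorm.exists_pow_sub_one_add_lt {A : Type*} [CommRing A] [Algebra ℝ A]
    (ρ : Seminorm ℝ A) (hρ : ∀ a b : A, ρ (a * b) ≤ ρ a * ρ b) {n : ℕ} (hn : n ≠ 0) {x : A}
    (hx : ρ x < 1) {ε : ℝ} (hε : 0 < ε) : ∃ y : A, ρ (y ^ n - (1 + x)) < ε := by
  let : SeminormedCommRing A := ρ.toSeminormedCommRing hρ
  let : NormedAlgebra ℝ A :=
    { (inferInstance : Algebra ℝ A) with
      norm_smul_le := fun r a => (map_smul_eq_mul ρ r a).le }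
  exact exists_norm_pow_sub_one_add_lt (A := A) hn hx hε
end

/-! ### States of an even power module and their extreme points. -/

noncomputable section

open Filter Topology

section States

variable {A : Type*} [CommRing A] [Algebra ℝ A] {ρ : Seminorm ℝ A} {d : ℕ} {S : PointedCone ℝ A}

/-- A `ρ`-bounded functional that is nonnegative on an even power module `S` is nonnegative on
`(1 + a) * S` if `ρ a < 1`. -/
theorem IsEvenPowerModule.map_one_add_mul_nonneg (hS : IsEvenPowerModule d S)
    (hρ : ∀ a b : A, ρ (a * b) ≤ ρ a * ρ b) (hd : 1 ≤ d) {φ : A →ₗ[ℝ] ℝ}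
    (hφ : ∀ s ∈ S, 0 ≤ φ s) {C : ℝ} (hC : 0 ≤ C) (hφC : ∀ a, |φ a| ≤ C * ρ a) {a : A}
    (ha : ρ a < 1) {s : A} (hs : s ∈ S) : 0 ≤ φ ((1 + a) * s) := by
  by_contra! hneg
  have hM : 0 < C * ρ s + 1 := by positivity
  -- With this tolerance `φ (y ^ (2 * d) * s)` is still negative, contradicting positivity on `S`.
  -- The `+ 1` in the denominator covers `C * ρ s = 0`.
  obtain ⟨y, hy⟩ := ρ.exists_pow_sub_one_add_lt hρ (n := 2 * d) (by omega) ha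
    (div_pos (neg_pos.2 hneg) hM)
  rw [lt_div_iff₀ hM] at hy
  have h1 := hφ _ (hS.pow_mul_mem y s hs)
  have h2 : φ ((y ^ (2 * d) - (1 + a)) * s) = φ (y ^ (2 * d) * s) - φ ((1 + a) * s) := by
    rw [sub_mul, map_sub]
  have h3 := (abs_le.1 (hφC ((y ^ (2 * d) - (1 + a)) * s))).2
  have h4 := mul_le_mul_of_nonneg_left (hρ (y ^ (2 * d) - (1 + a)) s) hC
  have h5 : 0 ≤ ρ (y ^ (2 * d) - (1 + a)) := apply_nonneg _ _
  nlinarith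

/-- A `ρ`-bounded functional that is nonnegative on an even power module has norm at most
its value at `1`. -/
theorem IsEvenPowerModule.abs_map_le (hS : IsEvenPowerModule d S)
    (hρ : ∀ a b : A, ρ (a * b) ≤ ρ a * ρ b) (hd : 1 ≤ d) {φ : A →ₗ[ℝ] ℝ}
    (hφ : ∀ s ∈ S, 0 ≤ φ s) {C : ℝ} (hC : 0 ≤ C) (hφC : ∀ a, |φ a| ≤ C * ρ a) (a : A) :
    |φ a| ≤ ρ a * φ 1 := by
  -- Positivity at `1 + r⁻¹ a` needs `ρ (r⁻¹ a) < 1`, hence `r > ρ a` strictly; the bound at `ρ a`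
  -- itself follows by letting `r` decrease to it.
  have key : ∀ a : A, ∀ r > ρ a, -(r * φ 1) ≤ φ a := by
    intro a r hr
    have hr0 : 0 < r := (apply_nonneg ρ a).trans_lt hr
    have h := hS.map_one_add_mul_nonneg hρ hd hφ hC hφC (a := r⁻¹ • a) (by
      rw [map_smul_eq_mul, Real.norm_of_nonneg (by positivity), inv_mul_lt_one₀ hr0]
      exact hr) hS.one_mem
    rw [mul_one, map_add, map_smul, smul_eq_mul] at h
    have h' := mul_nonneg hr0.le h
    rw [mul_add, mul_inv_cancel_left₀ hr0.ne'] at h'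
    linarith
  have h1 : 0 ≤ φ 1 := hφ 1 hS.one_mem
  have main : ∀ r > ρ a, |φ a| ≤ r * φ 1 := fun r hr => by
    have h2 := key (-a) r (by rwa [map_neg_eq_map])
    rw [map_neg] at h2
    exact abs_le.2 ⟨key a r hr, by linarith⟩
  refine ge_of_tendsto (x := 𝓝[>] (ρ a)) (f := fun r => r * φ 1) ?_
    (eventually_mem_nhdsWithin.mono main)
  exact ((continuous_id.mul continuous_const).tendsto _).mono_left nhdsWithin_le_nhds

/-- The linear functionals of norm at most `1` that are nonnegative on `S` and normalized at `1`. -/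
def stateSpace (ρ : Seminorm ℝ A) (S : PointedCone ℝ A) : Set (A → ℝ) :=
  {l | (∀ a b, l (a + b) = l a + l b) ∧ (∀ (r : ℝ) a, l (r • a) = r * l a) ∧ l 1 = 1 ∧
    (∀ s ∈ S, 0 ≤ l s) ∧ ∀ a, |l a| ≤ ρ a}

theorem LinearMap.mem_stateSpace {φ : A →ₗ[ℝ] ℝ} (h1 : φ 1 = 1) (hφ : ∀ s ∈ S, 0 ≤ φ s)
    (hφρ : ∀ a, |φ a| ≤ ρ a) : ⇑φ ∈ stateSpace ρ S :=
  ⟨map_add φ, fun r a => by simp, h1, hφ, hφρ⟩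

theorem exists_linearMap_of_mem_stateSpace {l : A → ℝ} (hl : l ∈ stateSpace ρ S) :
    ∃ φ : A →ₗ[ℝ] ℝ, ⇑φ = l :=
  ⟨{ toFun := l, map_add' := hl.1, map_smul' := hl.2.1 }, rfl⟩

theorem isClosed_stateSpace : IsClosed (stateSpace ρ S) := by
  simp only [stateSpace, Set.ofPred_and, Set.ofPred_forall]
  refine .inter ?_ (.inter ?_ (.inter ?_ (.inter ?_ ?_)))
  · exact isClosed_iInter fun a => isClosed_iInter fun b =>
      isClosed_eq (by fun_prop) (by fun_prop)
  · exact isClosed_iInter fun a => isClosed_iInter fun b =>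
      isClosed_eq (by fun_prop) (by fun_prop)
  · exact isClosed_eq (by fun_prop) (by fun_prop)
  · exact isClosed_iInter fun s => isClosed_iInter fun _ =>
      isClosed_le (by fun_prop) (by fun_prop)
  · exact isClosed_iInter fun a => isClosed_le (by fun_prop) (by fun_prop)

theorem isCompact_stateSpace : IsCompact (stateSpace ρ S) :=
  (isCompact_univ_pi fun a : A => isCompact_Icc (a := -ρ a) (b := ρ a)).of_isClosed_subset
    isClosed_stateSpace fun _ hl a _ => abs_le.1 (hl.2.2.2.2 a)

theorem convex_stateSpace : Convex ℝ (stateSpace ρ S) := by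
  rintro l ⟨ha, hs, h1, hp, hb⟩ m ⟨ha', hs', h1', hp', hb'⟩ s t hs0 ht0 hst
  simp only [stateSpace, Set.mem_ofPred_eq, Pi.add_apply, Pi.smul_apply, smul_eq_mul]
  refine ⟨fun a b => by rw [ha, ha']; ring, fun r a => by rw [hs, hs']; ring,
    by rw [h1, h1']; linarith,
    fun a h => add_nonneg (mul_nonneg hs0 (hp a h)) (mul_nonneg ht0 (hp' a h)), fun a => ?_⟩
  calc |s * l a + t * m a| ≤ |s * l a| + |t * m a| := abs_add_le _ _
    _ = s * |l a| + t * |m a| := by rw [abs_mul, abs_mul, abs_of_nonneg hs0, abs_of_nonneg ht0]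
    _ ≤ s * ρ a + t * ρ a :=
      add_le_add (mul_le_mul_of_nonneg_left (hb a) hs0) (mul_le_mul_of_nonneg_left (hb' a) ht0)
    _ = ρ a := by rw [← add_mul, hst, one_mul]

/-- The constant `C` is arbitrary because `abs_map_le` replaces it by `φ 1`. -/
theorem IsEvenPowerModule.div_mem_stateSpace (hS : IsEvenPowerModule d S)
    (hρ : ∀ a b : A, ρ (a * b) ≤ ρ a * ρ b) (hd : 1 ≤ d) {φ : A →ₗ[ℝ] ℝ}
    (hφ : ∀ s ∈ S, 0 ≤ φ s) {C : ℝ} (hC : 0 ≤ C) (hφC : ∀ a, |φ a| ≤ C * ρ a) (h1 : 0 < φ 1) :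
    (fun a => φ a / φ 1) ∈ stateSpace ρ S := by
  refine ⟨fun a b => by simp only [map_add, add_div], fun r a => by
    simp only [map_smul, smul_eq_mul, mul_div_assoc], div_self h1.ne',
    fun s hs => div_nonneg (hφ s hs) h1.le, fun a => ?_⟩
  simp only [abs_div]
  rw [abs_of_pos h1, div_le_iff₀ h1]
  exact hS.abs_map_le hρ hd hφ hC hφC a

/-- The functional `a ↦ φ ((1 + u) a)` is bounded and nonnegative on `S`, and its value `1 + φ u` at
`1` is positive. These are the perturbed states tested against extremality. -/
theorem IsEvenPowerModule.one_add_mul_div_mem_stateSpace (hS : IsEvenPowerModule d S)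
    (hρ : ∀ a b : A, ρ (a * b) ≤ ρ a * ρ b) (hd : 1 ≤ d) {φ : A →ₗ[ℝ] ℝ}
    (hφ : ⇑φ ∈ stateSpace ρ S) {u : A} (hu : ρ u < 1) :
    (fun a => (φ a + φ (u * a)) / (1 + φ u)) ∈ stateSpace ρ S := by
  have h := hS.div_mem_stateSpace hρ hd (φ := φ ∘ₗ LinearMap.mulLeft ℝ (1 + u))
    (C := ρ (1 + u)) ?_ (apply_nonneg _ _) (fun a => ?_) ?_
  · simpa [add_mul, hφ.2.2.1] using h
  · exact fun s hs => hS.map_one_add_mul_nonneg hρ hd hφ.2.2.2.1 zero_le_one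
      (by simpa using hφ.2.2.2.2) hu hs
  · exact (hφ.2.2.2.2 _).trans (hρ _ _)
  · have := (abs_le.1 (hφ.2.2.2.2 u)).1
    simp only [LinearMap.comp_apply, LinearMap.mulLeft_apply, mul_one, map_add, hφ.2.2.1]
    linarith

/-- The extreme states of an even power module are multiplicative. -/
theorem IsEvenPowerModule.map_mul_of_mem_extremePoints (hS : IsEvenPowerModule d S)
    (hρ : ∀ a b : A, ρ (a * b) ≤ ρ a * ρ b) (hd : 1 ≤ d) {l : A → ℝ}
    (hl : l ∈ (stateSpace ρ S).extremePoints ℝ) (a b : A) : l (a * b) = l a * l b := by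
  obtain ⟨φ, rfl⟩ := exists_linearMap_of_mem_stateSpace hl.1
  have hr : 0 < ρ a + 1 := by positivity
  set u := (ρ a + 1)⁻¹ • a with hu
  have hu1 : ρ u < 1 := by
    rw [hu, map_smul_eq_mul, Real.norm_of_nonneg (by positivity), inv_mul_lt_one₀ hr]
    linarith
  have hφu := abs_lt.1 ((hl.1.2.2.2.2 u).trans_lt hu1)
  have hm₁ := hS.one_add_mul_div_mem_stateSpace hρ hd hl.1 hu1
  have hm₂ := hS.one_add_mul_div_mem_stateSpace hρ hd hl.1 (u := -u) (by rwa [map_neg_eq_map])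
  -- The perturbations by `u` and `-u`, with weights `(1 ± φ u) / 2`, average to `φ`; extremality
  -- makes `φ` equal to the first, which says `φ (u * b) = φ u * φ b`.
  have hseg : ⇑φ ∈ openSegment ℝ (fun a => (φ a + φ (u * a)) / (1 + φ u))
      (fun a => (φ a + φ (-u * a)) / (1 + φ (-u))) := by
    refine ⟨(1 + φ u) / 2, (1 - φ u) / 2, by linarith, by linarith, by ring, ?_⟩
    funext c
    have h₁ : 1 + φ u ≠ 0 := by linarith
    have h₂ : 1 - φ u ≠ 0 := by linarith
    simp only [Pi.add_apply, Pi.smul_apply, smul_eq_mul, neg_mul, map_neg, ← sub_eq_add_neg]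
    field_simp
    ring
  have h := congrFun (hl.2 hm₁ hm₂ hseg) b
  rw [div_eq_iff (by linarith)] at h
  have hub : φ (u * b) = φ u * φ b := by linarith
  rw [hu, smul_mul_assoc, map_smul, map_smul, smul_eq_mul, smul_eq_mul, mul_assoc] at hub
  exact mul_left_cancel₀ (inv_ne_zero hr.ne') hub

theorem exists_charSpace_of_mem_stateSpace {l : A → ℝ} (hl : l ∈ stateSpace ρ S)
    (hmul : ∀ a b, l (a * b) = l a * l b) :
    ∃ α ∈ gelfandSpectrum ρ ∩ nonnegSet (S : Set A), ∀ a, (α : CharSpace A) a = l a := by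
  obtain ⟨φ, rfl⟩ := exists_linearMap_of_mem_stateSpace hl
  exact ⟨(AlgHom.ofLinearMap φ hl.2.2.1 hmul : A →ₐ[ℝ] ℝ), ⟨hl.2.2.2.2, hl.2.2.2.1⟩,
    fun _ => rfl⟩

/-- A bounded functional that is nonnegative on an even power module is nonnegative at every
element whose transform is nonnegative on the nonnegativity set. -/
theorem IsEvenPowerModule.map_nonneg (hS : IsEvenPowerModule d S)
    (hρ : ∀ a b : A, ρ (a * b) ≤ ρ a * ρ b) (hd : 1 ≤ d) {φ : A →ₗ[ℝ] ℝ}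
    (hφ : ∀ s ∈ S, 0 ≤ φ s) {C : ℝ} (hC : 0 ≤ C) (hφC : ∀ a, |φ a| ≤ C * ρ a) {a : A}
    (ha : ∀ α ∈ gelfandSpectrum ρ ∩ nonnegSet (S : Set A), 0 ≤ α a) : 0 ≤ φ a := by
  rcases (hφ 1 hS.one_mem).eq_or_lt with h1 | h1
  · have h := hS.abs_map_le hρ hd hφ hC hφC a
    rw [← h1, mul_zero] at h
    exact (abs_nonpos_iff.1 h).ge
  · have hmem := hS.div_mem_stateSpace hρ hd hφ hC hφC h1
    -- Krein–Milman: nonnegativity at `a` is a closed convex condition, so it is enough to test it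
    -- on extreme states, which are characters in `K`.
    rw [← closure_convexHull_extremePoints isCompact_stateSpace convex_stateSpace] at hmem
    have hsub : closure (convexHull ℝ ((stateSpace ρ S).extremePoints ℝ)) ⊆
        {l : A → ℝ | 0 ≤ l a} := by
      refine closure_minimal (convexHull_min ?_ ?_)
        (isClosed_le continuous_const (continuous_apply a))
      · intro l hl
        obtain ⟨α, hα, h⟩ := exists_charSpace_of_mem_stateSpace hl.1
          (hS.map_mul_of_mem_extremePoints hρ hd hl)
        exact (ha α hα).trans_eq (h a)
      · intro l hl m hm s t hs ht _
        exact add_nonneg (mul_nonneg hs hl) (mul_nonneg ht hm)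
    have h : 0 ≤ φ a / φ 1 := hsub hmem
    simpa [h1.ne'] using mul_nonneg h h1.le

end States
end

/-! ### Compactness of `K` and integral representation on compact spaces. -/

noncomputable section

open Filter Topology

section CharacterSpace

variable {A : Type*} [CommRing A] [Algebra ℝ A]

theorem CharSpace.isInducing_coeFun :
    IsInducing (fun (α : CharSpace A) (a : A) => α a) := ⟨rfl⟩

theorem CharSpace.continuous_eval (a : A) : Continuous fun α : CharSpace A => α a :=
  (continuous_apply a).comp CharSpace.isInducing_coeFun.continuous

instance CharSpace.instT2Space : T2Space (CharSpace A) :=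
  T2Space.of_injective_continuous (f := fun (α : CharSpace A) (a : A) => α a)
    DFunLike.coe_injective CharSpace.isInducing_coeFun.continuous

/-- Inside `A → ℝ` this set is the multiplicative part of the compact state space, and
multiplicativity is a closed condition. -/
theorem isCompact_gelfandSpectrum_inter_nonnegSet (ρ : Seminorm ℝ A) (S : PointedCone ℝ A) :
    IsCompact (gelfandSpectrum ρ ∩ nonnegSet (S : Set A)) := by
  rw [CharSpace.isInducing_coeFun.isCompact_iff]
  have h : (fun (α : CharSpace A) (a : A) => α a) '' (gelfandSpectrum ρ ∩ nonnegSet (S : Set A)) =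
      stateSpace ρ S ∩ {l | ∀ a b, l (a * b) = l a * l b} := by
    ext l
    constructor
    · rintro ⟨α, ⟨hρ, hS⟩, rfl⟩
      exact ⟨⟨map_add α, fun r a => by simp, map_one α, hS, hρ⟩, map_mul α⟩
    · rintro ⟨hl, hmul⟩
      obtain ⟨α, hα, h⟩ := exists_charSpace_of_mem_stateSpace hl hmul
      exact ⟨α, hα, funext h⟩
  rw [h]
  refine isCompact_stateSpace.inter_right ?_
  simp only [Set.ofPred_forall]
  exact isClosed_iInter fun a => isClosed_iInter fun b =>
    isClosed_eq (by fun_prop) (by fun_prop)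

/-- A functional on a space of continuous functions on a compact space `X`, given through a linear
map `T : E → C(X, ℝ)` whose range contains `1`, is represented by a finite regular measure if it is
nonnegative at the elements with nonnegative image. -/
theorem exists_regular_measure_of_nonneg {X E : Type*} [TopologicalSpace X] [CompactSpace X]
    [T2Space X] [MeasurableSpace X] [BorelSpace X] [AddCommGroup E] [Module ℝ E]
    (T : E →ₗ[ℝ] C(X, ℝ)) {e : E} (he : T e = 1) {φ : E →ₗ[ℝ] ℝ}
    (hφ : ∀ a, 0 ≤ T a → 0 ≤ φ a) :
    ∃ μ : Measure X, μ.Regular ∧ IsFiniteMeasure μ ∧ ∀ a, φ a = ∫ x, T a x ∂μ := by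
  -- A linear section of `T` transports `φ` to the range of `T`; the choice is harmless since `φ`
  -- vanishes on the kernel (`hker`).
  obtain ⟨g, hg⟩ := T.rangeRestrict.exists_rightInverse_of_surjective T.range_rangeRestrict
  have hTg : ∀ y : LinearMap.range T, T (g y) = y := fun y =>
    congrArg Subtype.val (LinearMap.congr_fun hg y)
  have hker : ∀ a, T a = 0 → φ a = 0 := fun a ha =>
    le_antisymm (by simpa using hφ (-a) (by simp [ha])) (hφ a ha.ge)
  let f : C(X, ℝ) →ₗ.[ℝ] ℝ := ⟨LinearMap.range T, φ ∘ₗ g⟩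
  let P : PointedCone ℝ C(X, ℝ) := PointedCone.positive ℝ C(X, ℝ)
  obtain ⟨Λ, hΛ, hΛ0⟩ := riesz_extension P f
    (fun x hx => hφ _ (((PointedCone.mem_positive ℝ _).1 hx).trans_eq (hTg x).symm))
    -- The constant `‖y‖`, in the range because `T e = 1`, majorizes `-y`: this is the cofinality
    -- required by the Riesz extension theorem.
    (fun y => ⟨⟨T (‖y‖ • e), LinearMap.mem_range_self _ _⟩, (PointedCone.mem_positive ℝ _).2 (by
      intro x
      have := (abs_le.1 (y.norm_coe_le_norm x)).1
      change 0 ≤ T (‖y‖ • e) x + y x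
      rw [map_smul, he]
      change 0 ≤ ‖y‖ * 1 + y x
      linarith)⟩)
  have hΛT : ∀ a, Λ (T a) = φ a := fun a => by
    have h1 : Λ (T a) = φ (g ⟨T a, LinearMap.mem_range_self _ _⟩) :=
      hΛ ⟨T a, LinearMap.mem_range_self _ _⟩
    have h2 := hker (g ⟨T a, LinearMap.mem_range_self _ _⟩ - a) (by rw [map_sub, hTg, sub_self])
    rw [h1, ← sub_eq_zero, ← map_sub, h2]
  let Λ' : CompactlySupportedContinuousMap X ℝ →ₚ[ℝ] ℝ :=
    PositiveLinearMap.mk₀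
      { toFun := fun h => Λ h.toContinuousMap
        map_add' := fun h k => map_add Λ h.toContinuousMap k.toContinuousMap
        map_smul' := fun c h => map_smul Λ c h.toContinuousMap }
      (fun h hh => hΛ0 _ ((PointedCone.mem_positive ℝ _).2 fun x => hh x))
  refine ⟨RealRMK.rieszMeasure Λ', inferInstance, inferInstance, fun a => ?_⟩
  rw [← hΛT]
  exact (RealRMK.integral_rieszMeasure Λ'
    ⟨T a, HasCompactSupport.of_compactSpace _⟩).symm

/-- Evaluation of the elements of `A` on a set of characters. -/
def evalOn (K : Set (CharSpace A)) : A →ₗ[ℝ] C(K, ℝ) where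
  toFun a := ⟨fun α => (α : CharSpace A) a, (CharSpace.continuous_eval a).comp
    continuous_subtype_val⟩
  map_add' a b := by ext α; exact map_add (α : CharSpace A) a b
  map_smul' r a := by ext α; exact map_smul (α : CharSpace A) r a

theorem integrable_eval_of_supported {ρ : Seminorm ℝ A} {S : PointedCone ℝ A}
    {μ : Measure (CharSpace A)} [IsFiniteMeasure μ]
    (h : ∀ᵐ α ∂μ, α ∈ gelfandSpectrum ρ ∩ nonnegSet (S : Set A)) (a : A) :
    Integrable (fun α : CharSpace A => α a) μ :=
  Integrable.of_bound (CharSpace.continuous_eval a).aestronglyMeasurable (ρ a)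
    (h.mono fun _ hα => hα.1 a)

/-! ### The sublinear function of the cone and the two implications. -/

variable {ρ : Seminorm ℝ A} {S : PointedCone ℝ A}

theorem bddBelow_range_seminorm_add (C : PointedCone ℝ A) (a : A) :
    BddBelow (Set.range fun p : C => ρ (a + (p : A))) :=
  ⟨0, by rintro _ ⟨p, rfl⟩; exact apply_nonneg _ _⟩

theorem coneSublinear_le {a p : A} (hp : p ∈ S) : coneSublinear S ρ a ≤ ρ (a + p) :=
  ciInf_le (bddBelow_range_seminorm_add S a) ⟨p, hp⟩

theorem coneSublinear_smul_le {c : ℝ} (hc : 0 < c) (a : A) :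
    coneSublinear S ρ (c • a) ≤ c * coneSublinear S ρ a := by
  rw [← div_le_iff₀' hc]
  refine le_ciInf fun p => ?_
  rw [div_le_iff₀' hc]
  have hp : c • (p : A) ∈ S := S.smul_mem hc.le p.2
  refine (coneSublinear_le hp).trans_eq ?_
  rw [← smul_add, map_smul_eq_mul, Real.norm_of_nonneg hc.le]

theorem coneSublinear_smul {c : ℝ} (hc : 0 < c) (a : A) :
    coneSublinear S ρ (c • a) = c * coneSublinear S ρ a := by
  refine (coneSublinear_smul_le hc a).antisymm ?_
  have h := coneSublinear_smul_le (S := S) (ρ := ρ) (inv_pos.2 hc) (c • a)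
  rwa [inv_smul_smul₀ hc.ne', le_inv_mul_iff₀ hc] at h

theorem coneSublinear_add (a b : A) :
    coneSublinear S ρ (a + b) ≤ coneSublinear S ρ a + coneSublinear S ρ b := by
  refine le_ciInf_add_ciInf fun p q => (coneSublinear_le (S.add_mem p.2 q.2)).trans ?_
  rw [add_add_add_comm]
  exact map_add_le_add ρ _ _

/-- A functional with a representing measure is dominated by a multiple of `coneSublinear`. -/
theorem IsRepresentingMeasure.exists_le_coneSublinear {B : Submodule ℝ A} {L : B →ₗ[ℝ] ℝ}
    {μ : Measure (CharSpace A)}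
    (hμ : IsRepresentingMeasure L (gelfandSpectrum ρ ∩ nonnegSet (S : Set A)) μ) :
    ∃ D : ℝ, 0 < D ∧ ∀ b : B, L b ≤ D * coneSublinear S ρ (b : A) := by
  have hK := isCompact_gelfandSpectrum_inter_nonnegSet ρ S
  set K := gelfandSpectrum ρ ∩ nonnegSet (S : Set A) with hKdef
  have hKc : μ Kᶜ = 0 := hμ.supported _ hK.measurableSet.compl (Set.compl_inter_self K)
  have hae : ∀ᵐ α ∂μ, α ∈ K := hKc
  have : IsLocallyFiniteMeasure μ := hμ.radon.isLocallyFinite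
  have hfin : IsFiniteMeasure μ := ⟨by
    rw [← Set.union_compl_self K]
    exact (measure_union_le _ _).trans_lt (by rw [hKc, add_zero]; exact hK.measure_lt_top)⟩
  -- The total mass already suffices as a bound; adding `1` keeps `D` positive when `μ = 0`.
  have hD : 0 < μ.real Set.univ + 1 := by positivity
  refine ⟨μ.real Set.univ + 1, hD, fun b => ?_⟩
  rw [← div_le_iff₀' hD]
  refine le_ciInf fun p => ?_
  rw [div_le_iff₀' hD, hμ.eq_integral b]
  calc ∫ α : CharSpace A, α (b : A) ∂μ
      ≤ ∫ _ : CharSpace A, ρ ((b : A) + p) ∂μ := by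
        refine integral_mono_ae (hμ.integrable b) (integrable_const _) (hae.mono fun α hα => ?_)
        have h1 := (abs_le.1 (hα.1 ((b : A) + p))).2
        have h2 := hα.2 p p.2
        rw [map_add] at h1
        change α (b : A) ≤ ρ ((b : A) + p)
        linarith
    _ = μ.real Set.univ * ρ ((b : A) + p) := by rw [integral_const, smul_eq_mul]
    _ ≤ (μ.real Set.univ + 1) * ρ ((b : A) + p) :=
        mul_le_mul_of_nonneg_right (by linarith) (apply_nonneg _ _)

/-- A functional dominated by a multiple of `coneSublinear` has a representing measure. -/
theorem IsEvenPowerModule.exists_isRepresentingMeasure {d : ℕ} (hS : IsEvenPowerModule d S)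
    (hρ : ∀ a b : A, ρ (a * b) ≤ ρ a * ρ b) (hd : 1 ≤ d) {B : Submodule ℝ A} {L : B →ₗ[ℝ] ℝ}
    {D : ℝ} (hD : 0 < D) (hL : ∀ b : B, L b ≤ D * coneSublinear S ρ (b : A)) :
    ∃ μ : Measure (CharSpace A),
      IsRepresentingMeasure L (gelfandSpectrum ρ ∩ nonnegSet (S : Set A)) μ := by
  obtain ⟨φ, hφL, hφ⟩ := exists_extension_of_le_sublinear ⟨B, L⟩
    (fun a => D * coneSublinear S ρ a)
    (fun c hc a => by rw [coneSublinear_smul hc]; ring)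
    (fun a b => by
      rw [← mul_add]
      exact mul_le_mul_of_nonneg_left (coneSublinear_add a b) hD.le) hL
  have hφS : ∀ s ∈ S, 0 ≤ φ s := fun s hs => by
    have h1 := hφ (-s)
    have h2 := mul_le_mul_of_nonneg_left (coneSublinear_le (ρ := ρ) (a := -s) hs) hD.le
    rw [neg_add_cancel, map_zero, mul_zero] at h2
    rw [map_neg] at h1
    linarith
  have hφle : ∀ a, φ a ≤ D * ρ a := fun a => (hφ a).trans <| by
    simpa using mul_le_mul_of_nonneg_left (coneSublinear_le (ρ := ρ) (a := a) S.zero_mem) hD.le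
  have hφρ : ∀ a, |φ a| ≤ D * ρ a := fun a => abs_le'.2 ⟨hφle a, by
    simpa [map_neg_eq_map] using hφle (-a)⟩
  have hK := isCompact_gelfandSpectrum_inter_nonnegSet ρ S
  set K := gelfandSpectrum ρ ∩ nonnegSet (S : Set A) with hKdef
  have : CompactSpace K := isCompact_iff_compactSpace.1 hK
  -- `map_nonneg` supplies exactly the positivity hypothesis for evaluation on `K`; `ν` lives on the
  -- subtype `K` and is then pushed forward to the character space.
  obtain ⟨ν, hν, hνfin, hνφ⟩ := exists_regular_measure_of_nonneg (evalOn K) (e := 1)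
    (by ext α; exact map_one (α : CharSpace A)) (φ := φ)
    (fun a ha => hS.map_nonneg hρ hd hφS hD.le hφρ fun α hα => ha ⟨α, hα⟩)
  have hsupp : IsSupportedIn (ν.map Subtype.val) K := fun M hM hMK => by
    rw [Measure.map_apply measurable_subtype_coe hM]
    convert measure_empty (μ := ν)
    exact Set.eq_empty_of_forall_notMem fun x hx =>
      (Set.eq_empty_iff_forall_notMem.1 hMK) x ⟨hx, x.2⟩
  refine ⟨ν.map Subtype.val, ⟨inferInstance,
    Measure.InnerRegular.map_of_continuous continuous_subtype_val⟩, hsupp,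
    fun b => integrable_eval_of_supported
      (hsupp _ hK.measurableSet.compl (Set.compl_inter_self K)) b, fun b => ?_⟩
  rw [integral_map measurable_subtype_coe.aemeasurable
    (CharSpace.continuous_eval (b : A)).aestronglyMeasurable]
  exact (hφL b).symm.trans (hνφ b)

end CharacterSpace

end

theorem mainTheorem1 {A : Type*} [CommRing A] [Algebra ℝ A]
    (ρ : Seminorm ℝ A) (hρ : ∀ a b : A, ρ (a * b) ≤ ρ a * ρ b)
    (B : Submodule ℝ A) (d : ℕ) (hd : 1 ≤ d)
    (S : PointedCone ℝ A) (hS : IsEvenPowerModule d S)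
    (L : B →ₗ[ℝ] ℝ) :
    (∃ μ : Measure (CharSpace A),
        IsRepresentingMeasure L (gelfandSpectrum ρ ∩ nonnegSet (S : Set A)) μ) ↔
      ∃ D : ℝ, 0 < D ∧ ∀ b : B, L b ≤ D * coneSublinear S ρ (b : A) :=
  ⟨fun ⟨_, hμ⟩ => hμ.exists_le_coneSublinear,
    fun ⟨_, hD, hL⟩ => hS.exists_isRepresentingMeasure hρ hd hD hL⟩
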